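/- Consider the gated, exhaustive $M/GI/\infty$ system. Customers arrive in a Poisson stream of rate $\lambda>0$; their service times $\sigma_1,\sigma_2,\dots$ are i.i.d. positive random variables, independent of the arrivals, with density $g$, distribution function $G$, $\overline G=1-G$, and finite moments of all orders. A stage that serves $k$ customers in parallel lasts as long as the largest of their $k$ service times; the next stage serves all customers who arrived during the present stage, or a single customer if nobody arrived. Thus the stage lengths form a Markov chain on $[0,\infty)$: given $Y_n=x$, $Y_{n+1}$ is distributed as the maximum of $\max(N,1)$ independent service times, where $N$ is Poisson with mean $\lambda x$ and independent of them. Let $f$ be an invariant density of this chain, and put $$\beta_k=\int_0^\infty x^kf(x)\,dx,\qquad \gamma_{m,k}=\mathbb E[\min(\sigma_1,\dots,\sigma_k)^m],\qquad q(x,y)=\big(\lambda xe^{-\lambda x\overline G(y)}+e^{-\lambda x}\big)g(y).$$ Then all moments $\beta_k$ are finite, $f(y)=\int_0^\infty f(x)q(x,y)\,dx$ for almost every $y\ge0$, and the following hold. (i) For every $i\ge2$, $$\beta_i=\gamma_{i,1}+\sum_{j=2}^\infty(-1)^j\frac{\lambda^j\beta_j}{j!}\,(\gamma_{i,1}-\gamma_{i,j})$$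 whenever the series converges (as a limit of partial sums). (ii) For every $y\ge0$ with $f(y)=\int_0^\infty f(x)q(x,y)\,dx$, $$f(y)=g(y)\Big[1+\sum_{k=2}^\infty(-1)^k\frac{\lambda^k\beta_k}{k!}\big(1-k\,\overline G(y)^{k-1}\big)\Big]$$ whenever the series converges (as a limit of partial sums). (iii) In light traffic, that is if $\mathbb E[e^{\lambda\sigma_1}]<\infty$, the series in (i) converges absolutely for every $i\ge2$ and the series in (ii) converges absolutely for every $y\ge0$ with $G(y)>0$. Hence the infinite linear system in (i) holds for all $i\ge2$, and the formula in (ii) holds at every $y\ge 0$ with $G(y)>0$ at which $f(y)=\int_0^\infty f(x)q(x,y)\,dx$. Moreover, for almost every $y\ge0$ the formula holds after $g(y)$ is multiplied into the series term by term. -/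

import Mathlib

open MeasureTheory ProbabilityTheory Filter Topology
open scoped NNReal ENNReal Nat

namespace GatedQueue

noncomputable section

theorem measurable_poissonMeasure :
    Measurable (fun r : ℝ≥0 => (poissonMeasure r : Measure ℕ)) := by
  refine Measure.measurable_of_measurable_coe _ fun s hs => ?_
  simp only [poissonMeasure, Measure.sum_apply _ hs, Measure.smul_apply, smul_eq_mul]
  refine Measurable.ennreal_tsum fun n => Measurable.mul_const ?_ _
  exact (by fun_prop : Measurable fun r : ℝ≥0 =>
    (Real.exp (-(r : ℝ)) * (r : ℝ) ^ n / (n ! : ℝ))).ennreal_ofReal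

/-- Number of arrivals of a Poisson process of rate `lam` during a time interval of length `x`:
its law is Poisson with mean `lam * x`. (Lengths `x` are nonnegative; a negative real is treated
as length `0`.) -/
def arrivals (lam : ℝ) : Kernel ℝ ℕ where
  toFun x := poissonMeasure (lam * x).toNNReal
  measurable' := measurable_poissonMeasure.comp (by fun_prop)

/-- Number of customers served in the next stage, given the length `x` of the present stage: the
customers who arrived during the present stage or, if there were none, a single one. -/
def nextCustomers (lam : ℝ) : Kernel ℝ ℕ := (arrivals lam).map (fun n => max n 1)

/-- Length of a stage serving `k` customers in parallel: the law of the largest of `k` service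
times. -/
def serviceStage {Ω : Type*} [MeasurableSpace Ω] (P : Measure Ω) (σ : ℕ → Ω → ℝ) : Kernel ℕ ℝ :=
  Kernel.ofFunOfCountable fun k => P.map (fun ω => ⨆ j : Fin k, σ j ω)

/-- Transition kernel of the Markov chain of consecutive stage lengths of the gated `M/GI/∞`
system with arrival rate `lam` and service times distributed like the i.i.d. sequence `σ`. -/
def stageKernel {Ω : Type*} [MeasurableSpace Ω] (P : Measure Ω) (σ : ℕ → Ω → ℝ) (lam : ℝ) :
    Kernel ℝ ℝ :=
  serviceStage P σ ∘ₖ nextCustomers lam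

/-- `f` is an invariant probability density of the stage lengths. -/
structure IsInvariantDensity {Ω : Type*} [MeasurableSpace Ω] (P : Measure Ω) (σ : ℕ → Ω → ℝ)
    (lam : ℝ) (f : ℝ → ℝ) : Prop where
  measurable : Measurable f
  nonneg : ∀ y, 0 ≤ f y
  isProbability : IsProbabilityMeasure (volume.withDensity fun y => ENNReal.ofReal (f y))
  invariant : (stageKernel P σ lam).Invariant (volume.withDensity fun y => ENNReal.ofReal (f y))

/-- The `k`-th moment `∫₀^∞ x ^ k f(x) dx`. -/
def moment (f : ℝ → ℝ) (k : ℕ) : ℝ := ∫ x in Set.Ioi (0 : ℝ), x ^ k * f x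

/-- `γ_{m,k} = E[min(σ_1, …, σ_k) ^ m]`, for `k ≥ 1`; the service times are numbered from `0`. -/
def minMoment {Ω : Type*} [MeasurableSpace Ω] (P : Measure Ω) (σ : ℕ → Ω → ℝ) (m k : ℕ) : ℝ :=
  ∫ ω, (⨅ j : Fin k, σ j ω) ^ m ∂P

/-- The service time distribution function `G(y) = P(σ_1 ≤ y)`. -/
def serviceCDF {Ω : Type*} [MeasurableSpace Ω] (P : Measure Ω) (σ : ℕ → Ω → ℝ) (y : ℝ) : ℝ :=
  P.real {ω | σ 0 ω ≤ y}

/-- The complementary distribution function `1 - G(y)`. -/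
def serviceTail {Ω : Type*} [MeasurableSpace Ω] (P : Measure Ω) (σ : ℕ → Ω → ℝ) (y : ℝ) : ℝ :=
  1 - serviceCDF P σ y

/-- `q(x,y) = (lam x exp(-lam x (1 - G(y))) + exp(-lam x)) g(y)`. -/
def transitionDensity {Ω : Type*} [MeasurableSpace Ω] (P : Measure Ω) (σ : ℕ → Ω → ℝ) (lam : ℝ)
    (g : ℝ → ℝ) (x y : ℝ) : ℝ :=
  (lam * x * Real.exp (-lam * x * serviceTail P σ y) + Real.exp (-lam * x)) * g y

/-- The integral equation `f(y) = ∫₀^∞ f(x) q(x,y) dx` at the point `y`. It selects the version of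
an invariant density for which the series expansion holds pointwise. -/
def IntegralEquationAt {Ω : Type*} [MeasurableSpace Ω] (P : Measure Ω) (σ : ℕ → Ω → ℝ) (lam : ℝ)
    (g f : ℝ → ℝ) (y : ℝ) : Prop :=
  f y = ∫ x in Set.Ioi (0 : ℝ), f x * transitionDensity P σ lam g x y

/-- The `j`-th term `(-1)^j (lam^j β_j / j!) (γ_{i,1} - γ_{i,j})`, `j ≥ 2`, of the `i`-th equation
of the linear system. -/
def systemTerm {Ω : Type*} [MeasurableSpace Ω] (P : Measure Ω) (σ : ℕ → Ω → ℝ) (lam : ℝ)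
    (f : ℝ → ℝ) (i j : ℕ) : ℝ :=
  (-1) ^ j * (lam ^ j * moment f j / (j ! : ℝ)) * (minMoment P σ i 1 - minMoment P σ i j)

/-- The `k`-th term `(-1)^k (lam^k β_k / k!) (1 - k (1 - G(y))^(k-1))`, `k ≥ 2`, of the series for
the invariant density. -/
def densityTerm {Ω : Type*} [MeasurableSpace Ω] (P : Measure Ω) (σ : ℕ → Ω → ℝ) (lam : ℝ)
    (f : ℝ → ℝ) (y : ℝ) (k : ℕ) : ℝ :=
  (-1) ^ k * (lam ^ k * moment f k / (k ! : ℝ)) * (1 - k * serviceTail P σ y ^ (k - 1))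

end

end GatedQueue

/-! Write `μ` for the service law, `π` for the invariant law, `T = 1 - G`. Averaging `G ^ max N 1`
over the Poisson number `N` and differentiating in `G` shows that the stage kernel has density `r
exp (-r T(y)) + exp (-r)`, `r = lam * x`, with respect to `μ`. Invariance then gives `π = R · μ`
with `R(y) = E[lam Y exp (-lam Y T(y)) + exp (-lam Y)]`, `Y` of law `π`, so that `f = g R` almost
everywhere. The integral equation at `y` says exactly `f y = g y * R y`.

Moments: the kernel density is at most `1 + lam * x`, so a nonnegative `h` satisfies `∫ h dπ ≤ E[1 +
lam Y] ∫ h dμ`. Once `E[Y]` is finite, every power moment, and in light traffic the exponential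
moment, passes from `μ` to `π`. Finiteness comes from a drift argument with `x ^ 2`, which dominates
the linear factor for every `lam`; hence no load condition is needed.

Series: expand `z exp (-z a) + exp (-z)` in powers of `z`; the linear terms cancel, so the sums
start at 2. Taylor remainders of `exp (-z)` on `z ≥ 0` are bounded by the first omitted term, and
this survives integration against `π`, and then against `y ^ i dμ`, where `k T ^ (k - 1)` is the
density of the minimum of `k` service times and produces `γ_{i,k}`. The resulting error is at most a
constant times the next term of the series itself (`eventually_one_add_mul_pow_le`,
`minMoment_two_lt_one`). Therefore mere convergence, which forces the terms to 0, identifies the sum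
(`eq_of_tendsto_sum_of_remainder_le`). -/

namespace GatedQueue

/-! ### Continuous distribution functions and densities relative to them -/

theorem continuous_cdf (μ : Measure ℝ) [IsProbabilityMeasure μ] [NullSingletonClass μ] :
    Continuous (cdf μ) := by
  refine continuous_iff_continuousAt.2 fun x => ?_
  rw [(monotone_cdf μ).continuousAt_iff_leftLim_eq_rightLim, StieltjesFunction.rightLim_eq]
  have h : (cdf μ).measure {x} = 0 := by rw [measure_cdf]; simp
  rw [StieltjesFunction.measure_singleton, ENNReal.ofReal_eq_zero] at h
  have := (monotone_cdf μ).leftLim_le (le_refl x)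
  linarith

/-- Continuity lets the intermediate value theorem pick `y` with `cdf μ y` equal to any value in
`(0, 1)`. Such points at `u` bound the measure from below, and at levels just above `u` from above.
The endpoints are separate because 0 and 1 need not be attained. -/
theorem measure_cdf_le (μ : Measure ℝ) [IsProbabilityMeasure μ] [NullSingletonClass μ] {u : ℝ}
    (h0 : 0 ≤ u) (h1 : u ≤ 1) : μ {t | cdf μ t ≤ u} = ENNReal.ofReal u := by
  have hiv : ∀ v, 0 < v → v < 1 → ∃ y, cdf μ y = v := fun v hv0 hv1 =>
    mem_range_of_exists_le_of_exists_ge (continuous_cdf μ)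
      (((tendsto_cdf_atBot μ).eventually (eventually_le_nhds hv0)).exists)
      (((tendsto_cdf_atTop μ).eventually (eventually_ge_nhds hv1)).exists)
  refine le_antisymm ?_ ?_
  · rcases eq_or_lt_of_le h1 with rfl | h1
    · simpa using prob_le_one
    refine le_of_forall_gt fun c hc => ?_
    obtain ⟨w, hw, hwc⟩ : ∃ w : ℝ, (u < w ∧ w < 1) ∧ ENNReal.ofReal w < c := by
      have h2 : ∀ᶠ w in 𝓝[>] u, ENNReal.ofReal w < c :=
        nhdsWithin_le_nhds ((ENNReal.continuous_ofReal.tendsto u).eventually (eventually_lt_nhds hc))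
      have h3 : ∀ᶠ w in 𝓝[>] u, u < w ∧ w < 1 := Ioo_mem_nhdsGT h1
      obtain ⟨w, hw⟩ := (h3.and h2).exists
      exact ⟨w, hw⟩
    obtain ⟨y, hy⟩ := hiv w (by linarith) hw.2
    refine lt_of_le_of_lt ?_ hwc
    rw [← hy, ofReal_cdf]
    refine measure_mono fun t ht => ?_
    by_contra hty
    have := monotone_cdf μ (le_of_lt (not_le.1 hty))
    have ht' : cdf μ t ≤ u := ht
    linarith [hw.1]
  · rcases eq_or_lt_of_le h0 with rfl | h0
    · simp
    rcases eq_or_lt_of_le h1 with rfl | h1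
    · have : {t | cdf μ t ≤ 1} = Set.univ := Set.eq_univ_of_forall fun t => cdf_le_one μ t
      simp [this]
    obtain ⟨y, hy⟩ := hiv u h0 h1
    nth_rewrite 1 [← hy]
    rw [ofReal_cdf]
    exact measure_mono fun t ht => (monotone_cdf μ ht).trans hy.le

/-- The probability integral transform. -/
theorem map_cdf (μ : Measure ℝ) [IsProbabilityMeasure μ] [NullSingletonClass μ] :
    μ.map (cdf μ) = volume.restrict (Set.Ioc 0 1) := by
  have hm : Measurable (cdf μ) := (monotone_cdf μ).measurable
  have := Measure.isProbabilityMeasure_map hm.aemeasurable (μ := μ)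
  refine Measure.ext_of_Iic _ _ fun u => ?_
  rw [Measure.map_apply hm measurableSet_Iic, Measure.restrict_apply measurableSet_Iic]
  rcases lt_or_ge u 0 with h | h
  · have h1 : cdf μ ⁻¹' Set.Iic u = ∅ := Set.eq_empty_of_forall_notMem fun t ht =>
      absurd (cdf_nonneg μ t) (not_le.2 (lt_of_le_of_lt ht h))
    have h2 : Set.Iic u ∩ Set.Ioc 0 1 = ∅ := Set.eq_empty_of_forall_notMem fun t ht =>
      absurd ht.2.1 (not_lt.2 (le_trans ht.1 h.le))
    simp [h1, h2]
  rcases le_total u 1 with h1 | h1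
  · have h2 : Set.Iic u ∩ Set.Ioc 0 1 = Set.Ioc 0 u := by
      ext t; simp only [Set.mem_inter_iff, Set.mem_Iic, Set.mem_Ioc]
      constructor
      · rintro ⟨a, b, c⟩; exact ⟨b, a⟩
      · rintro ⟨a, b⟩; exact ⟨b, a, b.trans h1⟩
    rw [h2, Real.volume_Ioc, sub_zero]
    exact measure_cdf_le μ h h1
  · have h2 : cdf μ ⁻¹' Set.Iic u = Set.univ :=
      Set.eq_univ_of_forall fun t => (cdf_le_one μ t).trans h1
    have h3 : Set.Iic u ∩ Set.Ioc 0 1 = Set.Ioc 0 1 :=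
      Set.inter_eq_right.2 fun t ht => ht.2.trans h1
    simp [h2, h3]

/-- Fundamental theorem of calculus along a continuous distribution function. -/
theorem setLIntegral_deriv_comp_cdf (μ : Measure ℝ) [IsProbabilityMeasure μ] [NullSingletonClass μ]
    {F F' : ℝ → ℝ} (hF : ∀ u, HasDerivAt F (F' u) u) (hc : Continuous F')
    (hnn : ∀ u ∈ Set.Icc (0 : ℝ) 1, 0 ≤ F' u) (y : ℝ) :
    ∫⁻ t in Set.Iic y, ENNReal.ofReal (F' (cdf μ t)) ∂μ
      = ENNReal.ofReal (F (cdf μ y) - F 0) := by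
  have hm : Measurable (cdf μ) := (monotone_cdf μ).measurable
  have h0 := cdf_nonneg μ y
  have h1 := cdf_le_one μ y
  -- The two sets differ only by a flat stretch of the distribution function to the right of `y`,
  -- which carries no mass.
  have hset : (Set.Iic y : Set ℝ) =ᵐ[μ] cdf μ ⁻¹' Set.Iic (cdf μ y) := by
    refine ae_eq_of_subset_of_measure_ge (fun t ht => monotone_cdf μ ht) ?_
      measurableSet_Iic.nullMeasurableSet (measure_ne_top _ _)
    rw [← ofReal_cdf]
    exact (measure_cdf_le μ h0 h1).le
  rw [setLIntegral_congr hset, ← setLIntegral_map measurableSet_Iic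
    (f := fun u => ENNReal.ofReal (F' u)) hc.measurable.ennreal_ofReal hm, map_cdf,
    Measure.restrict_restrict measurableSet_Iic]
  have h2 : Set.Iic (cdf μ y) ∩ Set.Ioc 0 1 = Set.Ioc 0 (cdf μ y) := by
    ext t; simp only [Set.mem_inter_iff, Set.mem_Iic, Set.mem_Ioc]
    constructor
    · rintro ⟨a, b, c⟩; exact ⟨b, a⟩
    · rintro ⟨a, b⟩; exact ⟨b, a, b.trans h1⟩
  rw [h2, ← intervalIntegral.integral_eq_sub_of_hasDerivAt (fun u _ => hF u)
    (hc.intervalIntegrable _ _), intervalIntegral.integral_of_le h0,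
    ofReal_integral_eq_lintegral_ofReal]
  · exact ((hc.intervalIntegrable _ _).1)
  · refine (ae_restrict_iff' measurableSet_Ioc).2 (ae_of_all _ fun u hu => ?_)
    exact hnn u ⟨hu.1.le, hu.2.trans h1⟩

/-- A probability law with distribution function `F ∘ G - F 0` has density `F' ∘ G` with respect
to the law with continuous distribution function `G`. -/
theorem eq_withDensity_of_cdf (μ ν : Measure ℝ) [IsProbabilityMeasure μ] [NullSingletonClass μ]
    [IsProbabilityMeasure ν] {F F' : ℝ → ℝ} (hF : ∀ u, HasDerivAt F (F' u) u)
    (hc : Continuous F') (hnn : ∀ u ∈ Set.Icc (0 : ℝ) 1, 0 ≤ F' u)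
    (hν : ∀ y, ν (Set.Iic y) = ENNReal.ofReal (F (cdf μ y) - F 0)) :
    ν = μ.withDensity fun t => ENNReal.ofReal (F' (cdf μ t)) := by
  refine Measure.ext_of_Iic _ _ fun y => ?_
  rw [hν, withDensity_apply _ measurableSet_Iic, setLIntegral_deriv_comp_cdf μ hF hc hnn]

/-! ### Maxima and minima of service times; the transition density -/

section ServiceTimes

variable {Ω : Type*} [MeasurableSpace Ω] {P : Measure Ω}
  {σ : ℕ → Ω → ℝ} {μ : Measure ℝ}

theorem serviceCDF_eq_cdf [IsProbabilityMeasure P] (hσ : Measurable (σ 0)) (hlaw : P.map (σ 0) = μ)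
    (y : ℝ) : serviceCDF P σ y = cdf μ y := by
  subst hlaw
  have := Measure.isProbabilityMeasure_map hσ.aemeasurable (μ := P)
  rw [cdf_eq_real, map_measureReal_apply hσ measurableSet_Iic]
  rfl

theorem measurable_iSup_fin (hσ : ∀ i, Measurable (σ i)) (k : ℕ) :
    Measurable fun ω => ⨆ j : Fin k, σ j ω := .iSup fun j => hσ j

theorem measurable_iInf_fin (hσ : ∀ i, Measurable (σ i)) (k : ℕ) :
    Measurable fun ω => ⨅ j : Fin k, σ j ω := .iInf fun j => hσ j

theorem map_iSup_Iic (hσ : ∀ i, Measurable (σ i)) (hind : iIndepFun σ P)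
    (hlaw : ∀ i, P.map (σ i) = μ) {k : ℕ} (hk : 1 ≤ k) (y : ℝ) :
    P.map (fun ω => ⨆ j : Fin k, σ j ω) (Set.Iic y) = μ (Set.Iic y) ^ k := by
  have : Nonempty (Fin k) := ⟨⟨0, hk⟩⟩
  rw [Measure.map_apply (measurable_iSup_fin hσ k) measurableSet_Iic]
  have h : (fun ω => ⨆ j : Fin k, σ j ω) ⁻¹' Set.Iic y
      = ⋂ j : Fin k, σ j ⁻¹' Set.Iic y := by
    ext ω
    simp [ciSup_le_iff (Set.finite_range fun j : Fin k => σ j ω).bddAbove]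
  rw [h, (hind.precomp (g := fun j : Fin k => (j : ℕ)) Fin.val_injective).meas_iInter
    fun j => ⟨_, measurableSet_Iic, rfl⟩]
  simp_rw [← Measure.map_apply (hσ _) (measurableSet_Iic (a := y)), hlaw]
  simp

theorem map_iInf_Ioi (hσ : ∀ i, Measurable (σ i)) (hind : iIndepFun σ P)
    (hlaw : ∀ i, P.map (σ i) = μ) {k : ℕ} (hk : 1 ≤ k) (y : ℝ) :
    P.map (fun ω => ⨅ j : Fin k, σ j ω) (Set.Ioi y) = μ (Set.Ioi y) ^ k := by
  have : Nonempty (Fin k) := ⟨⟨0, hk⟩⟩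
  rw [Measure.map_apply (measurable_iInf_fin hσ k) measurableSet_Ioi]
  have h : (fun ω => ⨅ j : Fin k, σ j ω) ⁻¹' Set.Ioi y
      = ⋂ j : Fin k, σ j ⁻¹' Set.Ioi y := by
    ext ω
    simp only [Set.mem_preimage, Set.mem_Ioi, Set.mem_iInter]
    constructor
    · exact fun h j => h.trans_le (ciInf_le (Set.finite_range _).bddBelow j)
    · intro h
      obtain ⟨j, hj⟩ := exists_eq_ciInf_of_finite (f := fun j : Fin k => σ j ω)
      rw [← hj]; exact h j
  rw [h, (hind.precomp (g := fun j : Fin k => (j : ℕ)) Fin.val_injective).meas_iInter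
    fun j => ⟨_, measurableSet_Ioi, rfl⟩]
  simp_rw [← Measure.map_apply (hσ _) (measurableSet_Ioi (a := y)), hlaw]
  simp

theorem map_iInf_eq_withDensity [IsProbabilityMeasure P] [IsProbabilityMeasure μ]
    [NullSingletonClass μ]
    (hσ : ∀ i, Measurable (σ i)) (hind : iIndepFun σ P)
    (hlaw : ∀ i, P.map (σ i) = μ) {k : ℕ} (hk : 1 ≤ k) :
    P.map (fun ω => ⨅ j : Fin k, σ j ω)
      = μ.withDensity fun y => ENNReal.ofReal (k * serviceTail P σ y ^ (k - 1)) := by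
  have hm := measurable_iInf_fin hσ k
  have := Measure.isProbabilityMeasure_map hm.aemeasurable (μ := P)
  simp only [serviceTail, serviceCDF_eq_cdf (hσ 0) (hlaw 0)]
  refine eq_withDensity_of_cdf μ _ (F := fun u => 1 - (1 - u) ^ k)
    (F' := fun u => k * (1 - u) ^ (k - 1)) (fun u => ?_) (by fun_prop) (fun u hu => ?_)
    fun y => ?_
  · have := (((hasDerivAt_id u).const_sub 1).pow k).const_sub 1
    convert! this using 1
    simp
  · have : 0 ≤ 1 - u := by linarith [hu.2]
    positivity
  · have h0 := cdf_nonneg μ y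
    have h1 := cdf_le_one μ y
    have h2 := prob_compl_eq_one_sub (μ := P.map fun ω => ⨅ j : Fin k, σ j ω)
      (measurableSet_Ioi (a := y))
    have h3 := prob_compl_eq_one_sub (μ := μ) (measurableSet_Iic (a := y))
    rw [Set.compl_Ioi] at h2
    rw [Set.compl_Iic, ← ofReal_cdf, ← ENNReal.ofReal_one, ← ENNReal.ofReal_sub _ h0] at h3
    rw [h2, map_iInf_Ioi hσ hind hlaw hk, h3, ← ENNReal.ofReal_pow (by linarith),
      ← ENNReal.ofReal_one, ← ENNReal.ofReal_sub _ (by positivity)]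
    simp

/-- The Poisson generating function with its `n = 0` term corrected from `1` to `u`, since an empty
queue still leads to one service. -/
theorem hasSum_poisson_max (r : ℝ≥0) (u : ℝ) :
    HasSum (fun n : ℕ => Real.exp (-r) * r ^ n / n ! * u ^ max n 1)
      (Real.exp (-(r * (1 - u))) + Real.exp (-r) * u - Real.exp (-r)) := by
  have h1 : HasSum (fun n : ℕ => Real.exp (-r) * r ^ n / n ! * u ^ n)
      (Real.exp (-(r * (1 - u)))) := by
    have := (NormedSpace.expSeries_div_hasSum_exp (r * u : ℝ)).mul_left (Real.exp (-r))
    rw [← Real.exp_eq_exp_ℝ, ← Real.exp_add] at this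
    convert! this using 1
    · ext n; rw [mul_pow]; ring
    · congr 1; ring
  have h2 : HasSum (fun n : ℕ => if n = 0 then Real.exp (-r) * (u - 1) else 0)
      (Real.exp (-r) * (u - 1)) := hasSum_ite_eq 0 _
  convert! h1.add h2 using 1
  · ext n
    rcases n with _ | n
    · simp; ring
    · simp
  · ring

theorem stageKernel_apply (P : Measure Ω) (σ : ℕ → Ω → ℝ) (lam x : ℝ) {s : Set ℝ}
    (hs : MeasurableSet s) :
    stageKernel P σ lam x s = ∫⁻ n, P.map (fun ω => ⨆ j : Fin (max n 1), σ j ω) s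
      ∂(poissonMeasure (lam * x).toNNReal) := by
  rw [stageKernel, Kernel.comp_apply' _ _ _ hs, nextCustomers,
    Kernel.lintegral_map _ (by fun_prop) _ (by fun_prop)]
  rfl

theorem isMarkovKernel_stageKernel [IsProbabilityMeasure P] (hσ : ∀ i, Measurable (σ i))
    (lam : ℝ) : IsMarkovKernel (stageKernel P σ lam) := by
  refine ⟨fun x => ⟨?_⟩⟩
  rw [stageKernel_apply _ _ _ _ .univ]
  have : ∀ n : ℕ, P.map (fun ω => ⨆ j : Fin (max n 1), σ j ω) Set.univ = 1 := fun n => by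
    rw [Measure.map_apply (measurable_iSup_fin hσ _) .univ]; simp
  simp [this]

/-- The transition law has density `r exp (-r (1 - G)) + exp (-r)`, `r = lam * x`, with respect to
the service time law. -/
theorem stageKernel_eq_withDensity [IsProbabilityMeasure P] [IsProbabilityMeasure μ]
    [NullSingletonClass μ]
    (hσ : ∀ i, Measurable (σ i)) (hind : iIndepFun σ P)
    (hlaw : ∀ i, P.map (σ i) = μ) (lam x : ℝ) :
    stageKernel P σ lam x = μ.withDensity fun y => ENNReal.ofReal
      ((lam * x).toNNReal * Real.exp (-((lam * x).toNNReal * serviceTail P σ y))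
        + Real.exp (-((lam * x).toNNReal : ℝ))) := by
  simp only [serviceTail, serviceCDF_eq_cdf (hσ 0) (hlaw 0)]
  set r := (lam * x).toNNReal
  have := isMarkovKernel_stageKernel (P := P) hσ lam
  refine eq_withDensity_of_cdf μ _
    -- Here `F u - F 0` is the generating function of `max N 1`, because `F 0 = exp (-r)`.
    (F := fun u => Real.exp (-(r * (1 - u))) + Real.exp (-r) * u)
    (F' := fun u => r * Real.exp (-(r * (1 - u))) + Real.exp (-r)) (fun u => ?_) (by fun_prop)
    (fun u hu => by positivity) fun y => ?_
  · have h1 := ((((hasDerivAt_id u).const_sub 1).const_mul (r : ℝ)).neg).exp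
    have h2 := (hasDerivAt_id u).const_mul (Real.exp (-(r : ℝ)))
    convert! h1.add h2 using 1
    simp; ring
  · have h0 := cdf_nonneg μ y
    rw [stageKernel_apply _ _ _ _ measurableSet_Iic]
    change ∫⁻ n, _ ∂(poissonMeasure r) = _
    simp_rw [map_iSup_Iic hσ hind hlaw (le_max_right _ 1), ← ofReal_cdf, ← ENNReal.ofReal_pow h0]
    rw [poissonMeasure, lintegral_sum_measure]
    simp_rw [lintegral_smul_measure, lintegral_dirac, smul_eq_mul]
    have hs := hasSum_poisson_max r (cdf μ y)
    have hnn : ∀ n : ℕ, 0 ≤ Real.exp (-r) * r ^ n / (n ! : ℝ) := fun n => by positivity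
    simp_rw [← ENNReal.ofReal_mul (hnn _)]
    rw [← ENNReal.ofReal_tsum_of_nonneg (fun n => by positivity) hs.summable, hs.tsum_eq]
    simp

end ServiceTimes

/-! ### The transition weight and a truncated drift inequality -/

/-- The density `r exp (-r t) + exp (-r)`, `r = max (lam * x) 0`, of the transition law with respect
to the service time law, where `t` is the value of the complementary distribution function. -/
noncomputable def stageWeight (lam x t : ℝ) : ℝ :=
  (lam * x).toNNReal * Real.exp (-((lam * x).toNNReal * t)) + Real.exp (-((lam * x).toNNReal : ℝ))

theorem stageWeight_le (lam x : ℝ) {t : ℝ} (ht : 0 ≤ t) :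
    stageWeight lam x t ≤ 1 + (lam * x).toNNReal := by
  unfold stageWeight
  have h1 : Real.exp (-((lam * x).toNNReal * t)) ≤ 1 := by
    rw [Real.exp_le_one_iff]; have : 0 ≤ (lam * x).toNNReal * t := by positivity
    linarith
  have h2 : Real.exp (-((lam * x).toNNReal : ℝ)) ≤ 1 := by
    rw [Real.exp_le_one_iff]; simp
  have := mul_le_mul_of_nonneg_left h1 (lam * x).toNNReal.coe_nonneg
  linarith

theorem measurable_stageWeight (lam : ℝ) :
    Measurable fun p : ℝ × ℝ => stageWeight lam p.1 p.2 := by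
  unfold stageWeight; fun_prop

/-- If the truncations of `V` satisfy the drift inequality `E min(V, M) ≤ E min(M, V / 2 + C)`,
then `E V ≤ 2 C`, even if `V` is not known to be integrable beforehand. -/
theorem lintegral_half_le_of_drift {α : Type*} [MeasurableSpace α] (ν : Measure α)
    [IsProbabilityMeasure ν] {V : α → ℝ} (hV : Measurable V) (hV0 : ∀ x, 0 ≤ V x) {C : ℝ}
    (hC : 0 ≤ C)
    (h : ∀ M : ℕ, ∫⁻ x, ENNReal.ofReal (min (V x) M) ∂ν
      ≤ ∫⁻ x, ENNReal.ofReal (min M (V x / 2 + C)) ∂ν) :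
    ∫⁻ x, ENNReal.ofReal (V x / 2) ∂ν ≤ ENNReal.ofReal C := by
  have hS : ∀ M : ℕ, MeasurableSet {x | V x ≤ M} := fun M => hV measurableSet_Iic
  have key : ∀ M : ℕ, ∫⁻ x in {x | V x ≤ M}, ENNReal.ofReal (V x / 2) ∂ν ≤ ENNReal.ofReal C := by
    intro M
    have hfin : ∫⁻ x, ENNReal.ofReal (min (V x) M) ∂ν ≠ ∞ := by
      refine ne_top_of_le_ne_top (b := ∫⁻ _, ENNReal.ofReal M ∂ν) (by simp) ?_
      exact lintegral_mono fun x => ENNReal.ofReal_le_ofReal (min_le_right _ _)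
    refine (ENNReal.add_le_add_iff_left hfin).1 ?_
    -- Truncation makes the left term finite, so it can be cancelled. Pointwise, where `V ≤ M`,
    -- adding `V / 2` to `V / 2 + C` gives `V + C`; where `V > M`, both truncations are at most `M =
    -- min V M` and nothing is added.
    calc ∫⁻ x, ENNReal.ofReal (min (V x) M) ∂ν
          + ∫⁻ x in {x | V x ≤ M}, ENNReal.ofReal (V x / 2) ∂ν
        ≤ ∫⁻ x, ENNReal.ofReal (min M (V x / 2 + C)) ∂ν
          + ∫⁻ x in {x | V x ≤ M}, ENNReal.ofReal (V x / 2) ∂ν := add_le_add_left (h M) _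
      _ = ∫⁻ x, (ENNReal.ofReal (min M (V x / 2 + C))
          + {x | V x ≤ M}.indicator (fun x => ENNReal.ofReal (V x / 2)) x) ∂ν := by
        rw [lintegral_add_left (by fun_prop), lintegral_indicator (hS M)]
      _ ≤ ∫⁻ x, (ENNReal.ofReal (min (V x) M) + ENNReal.ofReal C) ∂ν := by
        refine lintegral_mono fun x => ?_
        have hx := hV0 x
        by_cases hM : V x ≤ M
        · rw [Set.indicator_of_mem (show x ∈ {x | V x ≤ M} from hM), min_eq_left hM,
            ← ENNReal.ofReal_add (le_min (by positivity) (by positivity)) (by positivity),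
            ← ENNReal.ofReal_add hx hC]
          refine ENNReal.ofReal_le_ofReal ?_
          have := min_le_right (M : ℝ) (V x / 2 + C)
          linarith
        · rw [Set.indicator_of_notMem (show x ∉ {x | V x ≤ M} from hM), add_zero,
            min_eq_right (not_le.1 hM).le]
          exact (ENNReal.ofReal_le_ofReal (min_le_left _ _)).trans le_self_add
      _ = ∫⁻ x, ENNReal.ofReal (min (V x) M) ∂ν + ENNReal.ofReal C := by
        rw [lintegral_add_left (by fun_prop)]; simp
  have hU : ⋃ M : ℕ, {x | V x ≤ M} = Set.univ :=
    Set.eq_univ_of_forall fun x => Set.mem_iUnion.2 (exists_nat_ge (V x))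
  rw [← setLIntegral_univ, ← hU, setLIntegral_iUnion_of_directed]
  · exact iSup_le key
  · refine Monotone.directed_le fun M N hMN x hx => ?_
    exact le_trans (show V x ≤ M from hx) (by exact_mod_cast hMN)

/-! ### The invariant law: absolute continuity and finite moments -/

section Invariant

variable {μ π : Measure ℝ} {κ : Kernel ℝ ℝ}
  {lam : ℝ} {T : ℝ → ℝ}

theorem measurable_ofReal_stageWeight (hT : Measurable T) :
    Measurable (Function.uncurry fun x y => ENNReal.ofReal (stageWeight lam x (T y))) :=
  ((measurable_stageWeight lam).comp
    (measurable_fst.prodMk (hT.comp measurable_snd))).ennreal_ofReal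

theorem lintegral_eq_of_invariant [SFinite μ] (hinv : κ.Invariant π) (hT : Measurable T)
    (hκ : ∀ x, κ x = μ.withDensity fun y => ENNReal.ofReal (stageWeight lam x (T y)))
    {h : ℝ → ℝ≥0∞} (hh : Measurable h) :
    ∫⁻ y, h y ∂π = ∫⁻ x, ∫⁻ y, ENNReal.ofReal (stageWeight lam x (T y)) * h y ∂μ ∂π := by
  have hm := measurable_ofReal_stageWeight (lam := lam) hT
  conv_lhs => rw [← hinv.def, Measure.lintegral_bind κ.measurable.aemeasurable hh.aemeasurable]
  refine lintegral_congr fun x => ?_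
  rw [hκ, lintegral_withDensity_eq_lintegral_mul _ (hm.of_uncurry_left) hh]
  rfl

/-- The basic domination: one step from `x` costs at most a factor `1 + lam * x` compared with a
single service time. -/
theorem lintegral_stageWeight_mul_le (hT0 : ∀ y, 0 ≤ T y) (h : ℝ → ℝ≥0∞) (x : ℝ) :
    ∫⁻ y, ENNReal.ofReal (stageWeight lam x (T y)) * h y ∂μ
      ≤ ENNReal.ofReal (1 + (lam * x).toNNReal) * ∫⁻ y, h y ∂μ := by
  rw [← lintegral_const_mul' _ _ ENNReal.ofReal_ne_top]
  refine lintegral_mono fun y => ?_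
  gcongr
  exact stageWeight_le lam x (hT0 y)

theorem eq_withDensity_of_invariant [SFinite μ] [SFinite π] (hinv : κ.Invariant π) (hT : Measurable T)
    (hκ : ∀ x, κ x = μ.withDensity fun y => ENNReal.ofReal (stageWeight lam x (T y))) :
    π = μ.withDensity fun y => ∫⁻ x, ENNReal.ofReal (stageWeight lam x (T y)) ∂π := by
  have hm := measurable_ofReal_stageWeight (lam := lam) hT
  ext s hs
  rw [withDensity_apply _ hs, ← lintegral_indicator_one hs,
    lintegral_eq_of_invariant hinv hT hκ (measurable_one.indicator hs), lintegral_lintegral_swap]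
  · rw [← lintegral_indicator hs]
    refine lintegral_congr fun y => ?_
    by_cases hy : y ∈ s <;> simp [hy]
  · exact (hm.mul ((measurable_one.indicator hs).comp measurable_snd)).aemeasurable

/-- The drift inequality is applied to `V x = x ^ 2`. One step bounds its mean by a function linear
in `x`, which `x ^ 2 / 2` absorbs up to a constant whatever `lam` is; `V x = x` would need a small
load. -/
theorem lintegral_ofReal_one_add_lt_top [SFinite μ] [IsProbabilityMeasure π]
    [IsMarkovKernel κ] (hinv : κ.Invariant π) (hT : Measurable T)
    (hT0 : ∀ y, 0 ≤ T y)
    (hκ : ∀ x, κ x = μ.withDensity fun y => ENNReal.ofReal (stageWeight lam x (T y)))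
    (hlam : 0 < lam) (h2 : Integrable (fun y => y ^ 2) μ) :
    ∫⁻ x, ENNReal.ofReal (1 + (lam * x).toNNReal) ∂π < ∞ := by
  set m := ∫ y, y ^ 2 ∂μ with hm
  have hm0 : 0 ≤ m := integral_nonneg fun y => sq_nonneg y
  have hml : ∫⁻ y, ENNReal.ofReal (y ^ 2) ∂μ = ENNReal.ofReal m :=
    (ofReal_integral_eq_lintegral_ofReal h2 (ae_of_all _ fun y => sq_nonneg y)).symm
  set C := m + lam ^ 2 * m ^ 2 / 2 with hCdef
  have hC : 0 ≤ C := by positivity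
  -- The constant `C` comes from `0 ≤ (x - lam * m) ^ 2`, that is `lam * m * x ≤ x ^ 2 / 2 + lam ^ 2
  -- * m ^ 2 / 2`.
  have hb : ∀ x : ℝ, (1 + ((lam * x).toNNReal : ℝ)) * m ≤ x ^ 2 / 2 + C := fun x => by
    rw [Real.coe_toNNReal']
    rcases max_choice (lam * x) 0 with h | h <;> rw [h]
    · nlinarith [sq_nonneg (x - lam * m)]
    · nlinarith [sq_nonneg x, sq_nonneg (lam * m)]
  have hdrift := lintegral_half_le_of_drift π (V := fun x => x ^ 2) (by fun_prop)
    (fun x => sq_nonneg x) hC fun M => by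
      rw [lintegral_eq_of_invariant hinv hT hκ (by fun_prop)]
      refine lintegral_mono fun x => ?_
      rw [ENNReal.ofReal_min]
      refine le_min ?_ ?_
      · have hm := measurable_ofReal_stageWeight (lam := lam) hT
        calc ∫⁻ y, ENNReal.ofReal (stageWeight lam x (T y)) * ENNReal.ofReal (min (y ^ 2) M) ∂μ
            = ∫⁻ y, ENNReal.ofReal (min (y ^ 2) M) ∂(κ x) := by
              rw [hκ, lintegral_withDensity_eq_lintegral_mul _ hm.of_uncurry_left (by fun_prop)]
              rfl
          _ ≤ ∫⁻ _, ENNReal.ofReal M ∂(κ x) :=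
              lintegral_mono fun y => ENNReal.ofReal_le_ofReal (min_le_right _ _)
          _ = ENNReal.ofReal M := by simp
      · refine (lintegral_stageWeight_mul_le hT0 _ x).trans ?_
        refine le_trans ?_ (ENNReal.ofReal_le_ofReal (hb x))
        rw [ENNReal.ofReal_mul (by positivity), ← hml]
        gcongr
        exact min_le_left _ _
  refine lt_of_le_of_lt (b := ∫⁻ x, (ENNReal.ofReal (1 + lam ^ 2)
    + ENNReal.ofReal (x ^ 2 / 2)) ∂π) (lintegral_mono fun x => ?_) ?_
  · rw [← ENNReal.ofReal_add (by positivity) (by positivity)]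
    refine ENNReal.ofReal_le_ofReal ?_
    rw [Real.coe_toNNReal']
    rcases max_choice (lam * x) 0 with h | h <;> rw [h]
    · nlinarith [sq_nonneg (x - lam)]
    · nlinarith [sq_nonneg x]
  · rw [lintegral_add_left (by fun_prop)]
    simp only [lintegral_const, measure_univ, mul_one]
    exact ENNReal.add_lt_top.2 ⟨ENNReal.ofReal_lt_top, hdrift.trans_lt ENNReal.ofReal_lt_top⟩

theorem integrable_of_invariant [SFinite μ] [IsProbabilityMeasure π]
    [IsMarkovKernel κ] (hinv : κ.Invariant π) (hT : Measurable T)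
    (hT0 : ∀ y, 0 ≤ T y)
    (hκ : ∀ x, κ x = μ.withDensity fun y => ENNReal.ofReal (stageWeight lam x (T y)))
    (hlam : 0 < lam) (h2 : Integrable (fun y => y ^ 2) μ) {h : ℝ → ℝ} (hm : Measurable h)
    (hi : Integrable h μ) : Integrable h π := by
  refine ⟨hm.aestronglyMeasurable, ?_⟩
  rw [hasFiniteIntegral_iff_enorm, lintegral_eq_of_invariant hinv hT hκ (by fun_prop)]
  refine lt_of_le_of_lt (lintegral_mono fun x => lintegral_stageWeight_mul_le hT0 _ x) ?_
  rw [lintegral_mul_const' _ _ hi.2.ne]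
  exact ENNReal.mul_lt_top (lintegral_ofReal_one_add_lt_top hinv hT hT0 hκ hlam h2) hi.2

end Invariant

/-! ### Alternating expansions and their remainders -/

/-- Induction on `n`: the derivative of the signed remainder of order `n + 1` is the one of order
`n`, and the former vanishes at 0, so it increases from 0. -/
theorem neg_one_pow_mul_exp_neg_sub_sum_nonneg (n : ℕ) {z : ℝ} (hz : 0 ≤ z) :
    0 ≤ (-1) ^ n * (Real.exp (-z) - ∑ k ∈ Finset.range n, (-z) ^ k / (k ! : ℝ)) := by
  induction n generalizing z with
  | zero => simp [(Real.exp_pos _).le]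
  | succ n ih =>
    have hd : ∀ x : ℝ, HasDerivAt (fun z => (-1) ^ (n + 1) *
        (Real.exp (-z) - ∑ k ∈ Finset.range (n + 1), (-z) ^ k / (k ! : ℝ)))
        ((-1) ^ n * (Real.exp (-x) - ∑ k ∈ Finset.range n, (-x) ^ k / (k ! : ℝ))) x := by
      intro x
      have h1 := (hasDerivAt_neg x).exp
      have h2 : HasDerivAt (fun z : ℝ => ∑ k ∈ Finset.range (n + 1), (-z) ^ k / (k ! : ℝ))
          (-∑ k ∈ Finset.range n, (-x) ^ k / (k ! : ℝ)) x := by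
        have h3 := HasDerivAt.fun_sum (u := Finset.range (n + 1)) (x := x)
          (A := fun k z => (-z) ^ k / (k ! : ℝ))
          (A' := fun k => k * (-x) ^ (k - 1) * (-1) / (k ! : ℝ))
          fun k _ => ((hasDerivAt_neg x).pow k).div_const _
        convert! h3 using 1
        rw [Finset.sum_range_succ', ← Finset.sum_neg_distrib]
        simp only [Nat.cast_zero, zero_mul, zero_div, add_zero]
        refine Finset.sum_congr rfl fun k _ => ?_
        have : (k ! : ℝ) ≠ 0 := by positivity
        rw [Nat.factorial_succ]; push_cast
        field_simp
      convert! (h1.sub h2).const_mul ((-1 : ℝ) ^ (n + 1)) using 1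
      ring
    have hmono := monotoneOn_of_deriv_nonneg (convex_Ici (0 : ℝ))
      (fun x _ => (hd x).continuousAt.continuousWithinAt)
      (fun x _ => (hd x).differentiableAt.differentiableWithinAt) fun x hx => by
        rw [(hd x).deriv]
        rw [interior_Ici] at hx
        exact ih (le_of_lt hx)
    have := hmono (Set.self_mem_Ici) hz hz
    refine le_trans (le_of_eq ?_) this
    beta_reduce
    rw [Finset.sum_range_succ']
    simp

/-- Consecutive remainders have opposite signs, so each is no larger than the term separating them.
-/
theorem abs_exp_neg_sub_sum_le (n : ℕ) {z : ℝ} (hz : 0 ≤ z) :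
    |Real.exp (-z) - ∑ k ∈ Finset.range n, (-z) ^ k / (k ! : ℝ)| ≤ z ^ n / n ! := by
  have h0 := neg_one_pow_mul_exp_neg_sub_sum_nonneg n hz
  have h1 := neg_one_pow_mul_exp_neg_sub_sum_nonneg (n + 1) hz
  have h2 : (-1 : ℝ) ^ n * (-z) ^ n = z ^ n := by rw [← mul_pow]; simp
  have h3 : |Real.exp (-z) - ∑ k ∈ Finset.range n, (-z) ^ k / (k ! : ℝ)|
      = (-1) ^ n * (Real.exp (-z) - ∑ k ∈ Finset.range n, (-z) ^ k / (k ! : ℝ)) := by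
    rw [← abs_of_nonneg h0, abs_mul, abs_pow]; simp
  rw [h3, ← h2]
  rw [Finset.sum_range_succ, pow_succ] at h1
  have : (-1 : ℝ) ^ n * (-z) ^ n / n ! = (-1) ^ n * ((-z) ^ n / n !) := by ring
  rw [this]
  linarith

/-- The terms of the expansion of `z exp (-z a) + exp (-z)` in powers of `z`. -/
theorem one_add_sum_expansion {n : ℕ} (hn : 1 ≤ n) (z a : ℝ) :
    1 + ∑ k ∈ Finset.Icc 2 n, (-1) ^ k * (z ^ k / (k ! : ℝ)) * (1 - k * a ^ (k - 1))
      = ∑ k ∈ Finset.range (n + 1), (-z) ^ k / (k ! : ℝ)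
        + z * ∑ k ∈ Finset.range n, (-(z * a)) ^ k / (k ! : ℝ) := by
  induction n, hn using Nat.le_induction with
  | base => simp [Finset.sum_range_succ]
  | succ n hn ih =>
    rw [Finset.sum_Icc_succ_top (by lia), ← add_assoc, ih, Finset.sum_range_succ _ (n + 1),
      Finset.sum_range_succ _ n, Finset.sum_range_succ _ n, Nat.factorial_succ]
    simp only [Nat.add_sub_cancel, neg_pow z, neg_pow (z * a), mul_pow]
    have : (n ! : ℝ) ≠ 0 := by positivity
    push_cast
    field_simp
    ring

theorem abs_expansion_remainder_le {n : ℕ} (hn : 1 ≤ n) {z a : ℝ} (hz : 0 ≤ z) (ha : 0 ≤ a) :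
    |z * Real.exp (-(z * a)) + Real.exp (-z) - (1 + ∑ k ∈ Finset.Icc 2 n,
        (-1) ^ k * (z ^ k / (k ! : ℝ)) * (1 - k * a ^ (k - 1)))|
      ≤ z ^ (n + 1) / (n + 1)! * (1 + (n + 1 : ℕ) * a ^ n) := by
  rw [one_add_sum_expansion hn]
  have h1 := abs_exp_neg_sub_sum_le (n + 1) hz
  have h2 := mul_le_mul_of_nonneg_left (abs_exp_neg_sub_sum_le n (mul_nonneg hz ha)) hz
  rw [← abs_of_nonneg hz, ← abs_mul, abs_of_nonneg hz] at h2
  have h3 : z ^ (n + 1) / ((n + 1)! : ℝ) * (1 + (n + 1 : ℕ) * a ^ n)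
      = z ^ (n + 1) / (n + 1)! + z * ((z * a) ^ n / n !) := by
    have : (n ! : ℝ) ≠ 0 := by positivity
    rw [Nat.factorial_succ]; push_cast
    field_simp
    rw [mul_pow]
    ring
  rw [h3]
  refine le_trans (le_of_eq ?_) ((abs_add_le _ _).trans (add_le_add h1 h2))
  congr 1; ring

/-- Terms of a convergent series tend to 0, so an error controlled by the next term does too. No
absolute convergence or growth bound on the moments is required. -/
theorem eq_of_tendsto_sum_of_remainder_le {u : ℕ → ℝ} {L K s : ℝ}
    (h : Tendsto (fun n => ∑ k ∈ Finset.Icc 2 n, u k) atTop (𝓝 s))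
    (hr : ∀ᶠ n in atTop, |L - ∑ k ∈ Finset.Icc 2 n, u k| ≤ K * |u (n + 1)|) : L = s := by
  have h1 : Tendsto (fun n => u (n + 1)) atTop (𝓝 0) := by
    have := (h.comp (tendsto_add_atTop_nat 1)).sub h
    rw [sub_self] at this
    refine this.congr' ?_
    filter_upwards [eventually_ge_atTop 1] with n hn
    simp [Finset.sum_Icc_succ_top (show 2 ≤ n + 1 by lia)]
  have h2 : Tendsto (fun n => K * |u (n + 1)|) atTop (𝓝 0) := by
    simpa using h1.abs.const_mul K
  have h3 := squeeze_zero_norm' (f := fun n => L - ∑ k ∈ Finset.Icc 2 n, u k) hr h2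
  have h4 : Tendsto (fun n => L - ∑ k ∈ Finset.Icc 2 n, u k) atTop (𝓝 (L - s)) := h.const_sub L
  have := tendsto_nhds_unique h3 h4
  linarith

theorem tendsto_sum_Icc_two {u : ℕ → ℝ} (h : Summable fun j => u (j + 2)) :
    Tendsto (fun n => ∑ k ∈ Finset.Icc 2 n, u k) atTop (𝓝 (∑' j, u (j + 2))) := by
  rw [← tendsto_add_atTop_iff_nat 1]
  refine h.hasSum.tendsto_sum_nat.congr fun n => ?_
  rw [Finset.range_eq_Ico, Finset.sum_Ico_add' u 0 n 2]
  rfl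

theorem tendsto_natCast_mul_pow_sub_one {a : ℝ} (ha : 0 ≤ a) (ha1 : a < 1) :
    Tendsto (fun n : ℕ => (n : ℝ) * a ^ (n - 1)) atTop (𝓝 0) := by
  rw [← tendsto_add_atTop_iff_nat 1]
  have h1 := tendsto_self_mul_const_pow_of_lt_one ha ha1
  have h2 := tendsto_pow_atTop_nhds_zero_of_lt_one ha ha1
  have := h1.add h2
  rw [add_zero] at this
  refine this.congr fun n => ?_
  push_cast; ring_nf

/-- Converts the remainder bound, with factor `1 + n * a ^ (n - 1)`, into a multiple of the actual
term. It holds only eventually, since `1 - n * a ^ (n - 1)` can vanish. The constant 3 fits `n * a ^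
(n - 1) ≤ 1 / 2` when `a < 1`, and `1 + n ≤ 3 * (n - 1)` for `n ≥ 2` when `a = 1`. -/
theorem eventually_one_add_mul_pow_le {a : ℝ} (ha : 0 ≤ a) (ha1 : a ≤ 1) :
    ∀ᶠ n : ℕ in atTop, 1 + n * a ^ (n - 1) ≤ 3 * |1 - n * a ^ (n - 1)| := by
  rcases eq_or_lt_of_le ha1 with rfl | ha1
  · filter_upwards [eventually_ge_atTop 2] with n hn
    have : (2 : ℝ) ≤ n := by exact_mod_cast hn
    rw [one_pow, mul_one, abs_sub_comm, abs_of_nonneg (by linarith)]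
    linarith
  · filter_upwards [(tendsto_natCast_mul_pow_sub_one ha ha1).eventually
      (eventually_le_nhds (show (0 : ℝ) < 1 / 2 by norm_num))] with n hn
    rw [abs_of_nonneg (by linarith)]
    linarith

/-! ### Expansion of the density ratio in moments of the invariant law -/

/-- The factor `E (lam Y exp (-lam Y a) + exp (-lam Y))`, `Y` of law `π`, by which the service time
density is multiplied where the complementary distribution function equals `a`. -/
noncomputable def densityRatio (π : Measure ℝ) (lam a : ℝ) : ℝ :=
  ∫ x, (lam * x * Real.exp (-(lam * x * a)) + Real.exp (-(lam * x))) ∂π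

section Expansion

variable {π : Measure ℝ} {lam : ℝ}

theorem integrable_densityRatio [IsProbabilityMeasure π] (hlam : 0 < lam) (hpos : ∀ᵐ x ∂π, 0 < x)
    (hint : Integrable (fun x => x) π) {a : ℝ} (ha : 0 ≤ a) :
    Integrable (fun x => lam * x * Real.exp (-(lam * x * a)) + Real.exp (-(lam * x))) π := by
  refine ((hint.const_mul lam).add (integrable_const (1 : ℝ))).mono' (by fun_prop) ?_
  filter_upwards [hpos] with x hx
  have hx' : 0 ≤ lam * x := by positivity
  rw [Real.norm_of_nonneg (by positivity)]
  refine add_le_add (mul_le_of_le_one_right hx' ?_) ?_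
  · rw [Real.exp_le_one_iff]; have := mul_nonneg hx' ha; linarith
  · rw [Real.exp_le_one_iff]; linarith

theorem densityRatio_nonneg (hlam : 0 < lam) (hpos : ∀ᵐ x ∂π, 0 < x) (a : ℝ) :
    0 ≤ densityRatio π lam a := by
  refine integral_nonneg_of_ae ?_
  filter_upwards [hpos] with x hx
  show (0 : ℝ) ≤ _
  positivity

theorem abs_densityRatio_sub_le [IsProbabilityMeasure π] (hlam : 0 < lam) (hpos : ∀ᵐ x ∂π, 0 < x)
    (hint : ∀ k : ℕ, Integrable (fun x => x ^ k) π) {a : ℝ} (ha : 0 ≤ a) {n : ℕ} (hn : 1 ≤ n) :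
    |densityRatio π lam a - (1 + ∑ k ∈ Finset.Icc 2 n,
        (-1) ^ k * (lam ^ k * (∫ x, x ^ k ∂π) / (k ! : ℝ)) * (1 - k * a ^ (k - 1)))|
      ≤ lam ^ (n + 1) * (∫ x, x ^ (n + 1) ∂π) / (n + 1)! * (1 + (n + 1 : ℕ) * a ^ n) := by
  have hterm : ∀ k : ℕ, Integrable
      (fun x => (-1) ^ k * ((lam * x) ^ k / (k ! : ℝ)) * (1 - k * a ^ (k - 1))) π := fun k => by
    simp_rw [mul_pow]
    exact ((((hint k).const_mul _).div_const _).const_mul _).mul_const _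
  have h1 := integrable_densityRatio hlam hpos (by simpa using hint 1) ha
  have hs := integrable_finsetSum (Finset.Icc 2 n) fun k _ => hterm k
  have hs' : Integrable (fun x => 1 + ∑ k ∈ Finset.Icc 2 n,
      (-1) ^ k * ((lam * x) ^ k / (k ! : ℝ)) * (1 - k * a ^ (k - 1))) π :=
    (integrable_const _).add hs
  have heq : densityRatio π lam a - (1 + ∑ k ∈ Finset.Icc 2 n,
        (-1) ^ k * (lam ^ k * (∫ x, x ^ k ∂π) / (k ! : ℝ)) * (1 - k * a ^ (k - 1)))
      = ∫ x, (lam * x * Real.exp (-(lam * x * a)) + Real.exp (-(lam * x))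
        - (1 + ∑ k ∈ Finset.Icc 2 n,
          (-1) ^ k * ((lam * x) ^ k / (k ! : ℝ)) * (1 - k * a ^ (k - 1)))) ∂π := by
    rw [integral_sub h1 hs', integral_add (integrable_const _) hs,
      integral_finsetSum _ fun k _ => hterm k]
    simp_rw [integral_mul_const, integral_const_mul, integral_div, mul_pow, integral_const_mul]
    simp [densityRatio]
  have heq2 : lam ^ (n + 1) * (∫ x, x ^ (n + 1) ∂π) / (n + 1)! * (1 + (n + 1 : ℕ) * a ^ n)
      = ∫ x, (lam * x) ^ (n + 1) / (n + 1)! * (1 + (n + 1 : ℕ) * a ^ n) ∂π := by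
    simp_rw [integral_mul_const, integral_div, mul_pow, integral_const_mul]
  rw [heq, heq2]
  refine (abs_integral_le_integral_abs).trans (integral_mono_of_nonneg
    (ae_of_all _ fun x => abs_nonneg _) ?_ ?_)
  · simp_rw [mul_pow]
    exact (((hint _).const_mul _).div_const _).mul_const _
  · filter_upwards [hpos] with x hx
    exact abs_expansion_remainder_le hn (by positivity) ha

theorem integral_pow_nonneg (hpos : ∀ᵐ x ∂π, 0 < x) (k : ℕ) : 0 ≤ ∫ x, x ^ k ∂π := by
  refine integral_nonneg_of_ae ?_
  filter_upwards [hpos] with x hx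
  exact pow_nonneg hx.le k

theorem densityRatio_eq_of_tendsto [IsProbabilityMeasure π] (hlam : 0 < lam) (hpos : ∀ᵐ x ∂π, 0 < x)
    (hint : ∀ k : ℕ, Integrable (fun x => x ^ k) π) {a s : ℝ} (ha : 0 ≤ a) (ha1 : a ≤ 1)
    (h : Tendsto (fun n => ∑ k ∈ Finset.Icc 2 n,
      (-1) ^ k * (lam ^ k * (∫ x, x ^ k ∂π) / (k ! : ℝ)) * (1 - k * a ^ (k - 1)))
      atTop (𝓝 s)) : densityRatio π lam a = 1 + s := by
  rw [← sub_eq_iff_eq_add']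
  refine eq_of_tendsto_sum_of_remainder_le (K := 3) h ?_
  filter_upwards [(tendsto_add_atTop_nat 1).eventually (eventually_one_add_mul_pow_le ha ha1),
    eventually_ge_atTop 1] with n hn hn1
  rw [sub_sub]
  refine (abs_densityRatio_sub_le hlam hpos hint ha hn1).trans ?_
  have hb := integral_pow_nonneg hpos (n + 1)
  have hc : 0 ≤ lam ^ (n + 1) * (∫ x, x ^ (n + 1) ∂π) / ((n + 1)! : ℝ) := by positivity
  rw [abs_mul, abs_mul, abs_pow, abs_neg, abs_one, one_pow, one_mul, abs_of_nonneg hc]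
  have := mul_le_mul_of_nonneg_left hn hc
  simp only [Nat.add_sub_cancel] at this ⊢
  linarith

/-- The terms are nonnegative and their partial sums are means of Taylor polynomials of `exp (lam *
x)`, hence at most its mean. -/
theorem summable_moments (hlam : 0 < lam) (hpos : ∀ᵐ x ∂π, 0 < x)
    (hint : ∀ k : ℕ, Integrable (fun x => x ^ k) π)
    (hexp : Integrable (fun x => Real.exp (lam * x)) π) :
    Summable fun k : ℕ => lam ^ k * (∫ x, x ^ k ∂π) / (k ! : ℝ) := by
  refine summable_of_sum_range_le (c := ∫ x, Real.exp (lam * x) ∂π) (fun k => ?_) fun n => ?_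
  · have := integral_pow_nonneg hpos k
    positivity
  · have hterm : ∀ k : ℕ, Integrable (fun x => (lam * x) ^ k / (k ! : ℝ)) π := fun k => by
      simp_rw [mul_pow]
      exact ((hint k).const_mul _).div_const _
    have : ∑ k ∈ Finset.range n, lam ^ k * (∫ x, x ^ k ∂π) / (k ! : ℝ)
        = ∫ x, ∑ k ∈ Finset.range n, (lam * x) ^ k / (k ! : ℝ) ∂π := by
      rw [integral_finsetSum _ fun k _ => hterm k]
      simp_rw [integral_div, mul_pow, integral_const_mul]
    rw [this]
    refine integral_mono_ae (integrable_finsetSum _ fun k _ => hterm k) hexp ?_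
    filter_upwards [hpos] with x hx
    exact Real.sum_le_exp_of_nonneg (by positivity) n

end Expansion

/-! ### From laws to densities on the half-line -/

theorem setIntegral_Ioi_mul_eq {f h : ℝ → ℝ} (hf : Measurable f) (hf0 : ∀ x, 0 ≤ f x)
    (hpos : ∀ᵐ x ∂(volume.withDensity fun y => ENNReal.ofReal (f y)), 0 < x) :
    ∫ x in Set.Ioi (0 : ℝ), f x * h x
      = ∫ x, h x ∂(volume.withDensity fun y => ENNReal.ofReal (f y)) := by
  conv_rhs => rw [← Measure.restrict_eq_self_of_ae_mem (s := Set.Ioi (0 : ℝ)) hpos]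
  rw [setIntegral_withDensity_eq_setIntegral_toReal_smul hf.ennreal_ofReal
    (ae_of_all _ fun x => ENNReal.ofReal_lt_top) _ measurableSet_Ioi]
  simp [ENNReal.toReal_ofReal (hf0 _)]

theorem measurable_densityRatio (π : Measure ℝ) [SFinite π] (lam : ℝ) :
    Measurable (densityRatio π lam) := by
  unfold densityRatio
  refine (StronglyMeasurable.integral_prod_right' (f := fun p : ℝ × ℝ =>
    lam * p.2 * Real.exp (-(lam * p.2 * p.1)) + Real.exp (-(lam * p.2))) ?_).measurable
  exact Measurable.stronglyMeasurable (by fun_prop)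

theorem lintegral_stageWeight_eq {π : Measure ℝ} [IsProbabilityMeasure π] {lam : ℝ}
    (hlam : 0 < lam) (hpos : ∀ᵐ x ∂π, 0 < x) (hint : Integrable (fun x => x) π) {a : ℝ}
    (ha : 0 ≤ a) :
    ∫⁻ x, ENNReal.ofReal (stageWeight lam x a) ∂π = ENNReal.ofReal (densityRatio π lam a) := by
  rw [densityRatio, ofReal_integral_eq_lintegral_ofReal
    (integrable_densityRatio hlam hpos hint ha)]
  · refine lintegral_congr_ae ?_
    filter_upwards [hpos] with x hx
    simp only [stageWeight, Real.coe_toNNReal _ (by positivity : 0 ≤ lam * x)]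
  · filter_upwards [hpos] with x hx
    show (0 : ℝ) ≤ _
    positivity

theorem ae_eq_mul_of_withDensity_eq {f g R : ℝ → ℝ} (hf : Measurable f) (hf0 : ∀ x, 0 ≤ f x)
    (hg : Measurable g) (hg0 : ∀ x, 0 ≤ g x) (hR : Measurable R) (hR0 : ∀ x, 0 ≤ R x)
    (h : (volume.withDensity fun y => ENNReal.ofReal (f y))
      = (volume.withDensity fun y => ENNReal.ofReal (g y)).withDensity
        fun y => ENNReal.ofReal (R y)) :
    ∀ᵐ y, f y = g y * R y := by
  rw [← withDensity_mul _ hg.ennreal_ofReal hR.ennreal_ofReal,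
    withDensity_eq_iff_of_sigmaFinite hf.ennreal_ofReal.aemeasurable
      (hg.ennreal_ofReal.mul hR.ennreal_ofReal).aemeasurable] at h
  filter_upwards [h] with y hy
  rw [Pi.mul_apply, ← ENNReal.ofReal_mul (hg0 y)] at hy
  exact (ENNReal.ofReal_eq_ofReal_iff (hf0 y) (mul_nonneg (hg0 y) (hR0 y))).1 hy

/-! ### Remainder bound for the linear system -/

section System

variable {μ π : Measure ℝ} [IsProbabilityMeasure π] {lam : ℝ} {T : ℝ → ℝ}

theorem integrable_pow_mul_tail (hT : Measurable T) (hT0 : ∀ y, 0 ≤ T y) (hT1 : ∀ y, T y ≤ 1)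
    {i : ℕ} (hi : Integrable (fun y => y ^ i) μ) (c : ℝ) (k : ℕ) :
    Integrable (fun y => y ^ i * (c * T y ^ k)) μ := by
  refine hi.mul_bdd (c := |c|) (by fun_prop) (ae_of_all _ fun y => ?_)
  rw [Real.norm_eq_abs, abs_mul, abs_of_nonneg (pow_nonneg (hT0 y) k)]
  exact mul_le_of_le_one_right (abs_nonneg _) (pow_le_one₀ (hT0 y) (hT1 y))

/-- The pointwise remainder bound for the density ratio at `T y`, multiplied by `y ^ i` and
integrated against `μ`. The hypothesis on `γ` is what the moments of minima satisfy. -/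
theorem abs_moment_sub_le (hlam : 0 < lam) (hposμ : ∀ᵐ y ∂μ, 0 < y) (hpos : ∀ᵐ x ∂π, 0 < x)
    (hint : ∀ k : ℕ, Integrable (fun x => x ^ k) π) (hT : Measurable T) (hT0 : ∀ y, 0 ≤ T y)
    (hT1 : ∀ y, T y ≤ 1)
    (hπ : π = μ.withDensity fun y => ENNReal.ofReal (densityRatio π lam (T y))) {i : ℕ}
    (hi : Integrable (fun y => y ^ i) μ) {γ : ℕ → ℝ}
    (hγ : ∀ k, 1 ≤ k → γ k = ∫ y, y ^ i * (k * T y ^ (k - 1)) ∂μ) {n : ℕ} (hn : 1 ≤ n) :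
    |(∫ y, y ^ i ∂π) - (γ 1 + ∑ k ∈ Finset.Icc 2 n,
        (-1) ^ k * (lam ^ k * (∫ x, x ^ k ∂π) / (k ! : ℝ)) * (γ 1 - γ k))|
      ≤ lam ^ (n + 1) * (∫ x, x ^ (n + 1) ∂π) / (n + 1)! * (γ 1 + γ (n + 1)) := by
  set c : ℕ → ℝ := fun k => lam ^ k * (∫ x, x ^ k ∂π) / (k ! : ℝ) with hc
  have hR0 := densityRatio_nonneg hlam hpos
  have hRm : Measurable fun y => ENNReal.ofReal (densityRatio π lam (T y)) :=
    ((measurable_densityRatio π lam).comp hT).ennreal_ofReal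
  have htop : ∀ᵐ y ∂μ, ENNReal.ofReal (densityRatio π lam (T y)) < ∞ :=
    ae_of_all _ fun y => ENNReal.ofReal_lt_top
  have h1 : ∫ y, y ^ i ∂π = ∫ y, y ^ i * densityRatio π lam (T y) ∂μ := by
    conv_lhs => rw [hπ]
    rw [integral_withDensity_eq_integral_toReal_smul hRm htop]
    simp [ENNReal.toReal_ofReal (hR0 _), mul_comm]
  have h2 : Integrable (fun y => y ^ i * densityRatio π lam (T y)) μ := by
    have := hint i
    rw [hπ, integrable_withDensity_iff_integrable_smul' hRm htop] at this
    simpa [ENNReal.toReal_ofReal (hR0 _), mul_comm] using this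
  have hγ1 : γ 1 = ∫ y, y ^ i ∂μ := by simp [hγ 1 le_rfl]
  have hI := integrable_pow_mul_tail hT hT0 hT1 hi
  have hterm : ∀ k : ℕ, Integrable
      (fun y => (-1) ^ k * c k * (y ^ i - y ^ i * (k * T y ^ (k - 1)))) μ :=
    fun k => (hi.sub (hI _ _)).const_mul _
  have hs := integrable_finsetSum (Finset.Icc 2 n) fun k _ => hterm k
  have hs' : Integrable (fun y => y ^ i + ∑ k ∈ Finset.Icc 2 n,
      (-1) ^ k * c k * (y ^ i - y ^ i * (k * T y ^ (k - 1)))) μ := hi.add hs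
  have h3 : γ 1 + ∑ k ∈ Finset.Icc 2 n, (-1) ^ k * c k * (γ 1 - γ k)
      = ∫ y, (y ^ i + ∑ k ∈ Finset.Icc 2 n,
        (-1) ^ k * c k * (y ^ i - y ^ i * (k * T y ^ (k - 1)))) ∂μ := by
    rw [integral_add hi hs, integral_finsetSum _ fun k _ => hterm k, hγ1]
    congr 1
    refine Finset.sum_congr rfl fun k hk => ?_
    rw [integral_const_mul, integral_sub hi (hI _ _), hγ k (by grind)]
  have h4 : c (n + 1) * (γ 1 + γ (n + 1))
      = ∫ y, c (n + 1) * (y ^ i + y ^ i * ((n + 1 : ℕ) * T y ^ n)) ∂μ := by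
    rw [integral_const_mul, integral_add hi (hI _ _), hγ1, hγ (n + 1) (by lia)]
    simp
  change |_ - (γ 1 + ∑ k ∈ Finset.Icc 2 n, (-1) ^ k * c k * (γ 1 - γ k))|
    ≤ c (n + 1) * (γ 1 + γ (n + 1))
  rw [h1, h3, h4, ← integral_sub h2 hs']
  refine abs_integral_le_integral_abs.trans (integral_mono_of_nonneg
    (ae_of_all _ fun x => abs_nonneg _) ((hi.add (hI _ _)).const_mul _) ?_)
  filter_upwards [hposμ] with y hy
  have hyi : 0 ≤ y ^ i := by positivity
  have h5 := mul_le_mul_of_nonneg_left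
    (abs_densityRatio_sub_le hlam hpos hint (hT0 y) hn) hyi
  rw [← abs_of_nonneg hyi, ← abs_mul, abs_of_nonneg hyi] at h5
  refine le_trans (le_of_eq ?_) (h5.trans (le_of_eq ?_))
  · rw [mul_sub, mul_add, mul_one, Finset.mul_sum]
    congr 3
    refine Finset.sum_congr rfl fun k _ => ?_
    simp only [hc]; ring
  · simp only [hc]; ring

end System

/-! ### Moments of minima of service times -/

section MinMoment

variable {Ω : Type*} [MeasurableSpace Ω] {P : Measure Ω}
  {σ : ℕ → Ω → ℝ} {μ : Measure ℝ}

theorem minMoment_eq_integral [IsProbabilityMeasure P] [IsProbabilityMeasure μ]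
    [NullSingletonClass μ]
    (hσ : ∀ i, Measurable (σ i)) (hind : iIndepFun σ P)
    (hlaw : ∀ i, P.map (σ i) = μ) (i : ℕ) {k : ℕ} (hk : 1 ≤ k) :
    minMoment P σ i k = ∫ y, y ^ i * (k * serviceTail P σ y ^ (k - 1)) ∂μ := by
  have hm := measurable_iInf_fin hσ k
  have hT0 : ∀ y, 0 ≤ serviceTail P σ y := fun y => by
    rw [serviceTail, serviceCDF_eq_cdf (hσ 0) (hlaw 0)]; linarith [cdf_le_one μ y]
  have hTm : Measurable (serviceTail P σ) := by
    have : serviceTail P σ = fun y => 1 - cdf μ y := by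
      ext y; rw [serviceTail, serviceCDF_eq_cdf (hσ 0) (hlaw 0)]
    rw [this]
    exact (monotone_cdf μ).measurable.const_sub 1
  rw [minMoment, ← integral_map (f := fun y => y ^ i) hm.aemeasurable (by fun_prop),
    map_iInf_eq_withDensity hσ hind hlaw hk, integral_withDensity_eq_integral_toReal_smul
      (by fun_prop) (ae_of_all _ fun y => ENNReal.ofReal_lt_top)]
  refine integral_congr_ae (ae_of_all _ fun y => ?_)
  have := hT0 y
  simp only [smul_eq_mul]
  rw [ENNReal.toReal_ofReal (by positivity), mul_comm]

theorem iInf_fin_pos {x : ℕ → ℝ} (hx : ∀ j, 0 < x j) {k : ℕ} (hk : 1 ≤ k) :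
    0 < ⨅ j : Fin k, x j := by
  have : Nonempty (Fin k) := ⟨⟨0, hk⟩⟩
  obtain ⟨j, hj⟩ := exists_eq_ciInf_of_finite (f := fun j : Fin k => x j)
  rw [← hj]; exact hx j

theorem iInf_fin_anti (x : ℕ → ℝ) {k l : ℕ} (hk : 1 ≤ k) (hkl : k ≤ l) :
    ⨅ j : Fin l, x j ≤ ⨅ j : Fin k, x j := by
  have : Nonempty (Fin k) := ⟨⟨0, hk⟩⟩
  exact le_ciInf fun j => ciInf_le (Set.finite_range fun j : Fin l => x j).bddBelow
    (Fin.castLE hkl j)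

theorem iInf_fin_one (x : ℕ → ℝ) : ⨅ j : Fin 1, x j = x 0 := by
  rw [ciInf_unique]; rfl

theorem integrable_iInf_pow (hσ : ∀ i, Measurable (σ i)) (hpos : ∀ i, ∀ᵐ ω ∂P, 0 < σ i ω) {i : ℕ}
    (hi : Integrable (fun ω => σ 0 ω ^ i) P) {k : ℕ} (hk : 1 ≤ k) :
    Integrable (fun ω => (⨅ j : Fin k, σ j ω) ^ i) P := by
  have hm := measurable_iInf_fin hσ k
  refine hi.mono' (hm.pow_const i).aestronglyMeasurable ?_
  filter_upwards [ae_all_iff.2 hpos] with ω hω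
  have h0 := iInf_fin_pos hω hk
  rw [Real.norm_of_nonneg (by positivity), ← iInf_fin_one fun j => σ j ω]
  exact pow_le_pow_left₀ h0.le (iInf_fin_anti (fun j => σ j ω) le_rfl hk) i

theorem minMoment_nonneg (hpos : ∀ i, ∀ᵐ ω ∂P, 0 < σ i ω) (i : ℕ) {k : ℕ} (hk : 1 ≤ k) :
    0 ≤ minMoment P σ i k := by
  refine integral_nonneg_of_ae ?_
  filter_upwards [ae_all_iff.2 hpos] with ω hω
  exact pow_nonneg (iInf_fin_pos hω hk).le i

theorem minMoment_anti (hσ : ∀ i, Measurable (σ i)) (hpos : ∀ i, ∀ᵐ ω ∂P, 0 < σ i ω) {i : ℕ}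
    (hi : Integrable (fun ω => σ 0 ω ^ i) P) {k l : ℕ} (hk : 1 ≤ k) (hkl : k ≤ l) :
    minMoment P σ i l ≤ minMoment P σ i k := by
  refine integral_mono_ae (integrable_iInf_pow hσ hpos hi (hk.trans hkl))
    (integrable_iInf_pow hσ hpos hi hk) ?_
  filter_upwards [ae_all_iff.2 hpos] with ω hω
  exact pow_le_pow_left₀ (iInf_fin_pos hω (hk.trans hkl)).le (iInf_fin_anti (fun j => σ j ω) hk hkl) i

/-- Strictness keeps the factors `γ_{i,1} - γ_{i,j}`, `j ≥ 2`, bounded away from 0. Equality would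
make the minimum of two service times almost surely equal to the first, so `p ^ 2 = p` for each tail
probability `p`; this fails at a median, where `p = 1 / 2`. -/
theorem minMoment_two_lt_one [IsProbabilityMeasure P] [IsProbabilityMeasure μ]
    [NullSingletonClass μ]
    (hσ : ∀ i, Measurable (σ i)) (hind : iIndepFun σ P)
    (hlaw : ∀ i, P.map (σ i) = μ) (hpos : ∀ i, ∀ᵐ ω ∂P, 0 < σ i ω) {i : ℕ} (hi0 : i ≠ 0)
    (hi : Integrable (fun ω => σ 0 ω ^ i) P) :
    minMoment P σ i 2 < minMoment P σ i 1 := by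
  refine lt_of_le_of_ne (minMoment_anti hσ hpos hi le_rfl one_le_two) fun heq => ?_
  have h1 := integrable_iInf_pow hσ hpos hi le_rfl
  have h2 := integrable_iInf_pow hσ hpos hi one_le_two
  have hle : (fun ω => (⨅ j : Fin 2, σ j ω) ^ i) ≤ᵐ[P] fun ω => (⨅ j : Fin 1, σ j ω) ^ i := by
    filter_upwards [ae_all_iff.2 hpos] with ω hω
    exact pow_le_pow_left₀ (iInf_fin_pos hω one_le_two).le (iInf_fin_anti (fun j => σ j ω) le_rfl one_le_two) i
  have hae := (integral_eq_iff_of_ae_le h2 h1 hle).1 heq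
  have hae' : (fun ω => ⨅ j : Fin 2, σ j ω) =ᵐ[P] fun ω => ⨅ j : Fin 1, σ j ω := by
    filter_upwards [hae, ae_all_iff.2 hpos] with ω h hω
    exact (pow_left_inj₀ (iInf_fin_pos hω one_le_two).le (iInf_fin_pos hω le_rfl).le hi0).1 h
  obtain ⟨y, hy⟩ : ∃ y, cdf μ y = 1 / 2 := mem_range_of_exists_le_of_exists_ge
    (continuous_cdf μ)
    (((tendsto_cdf_atBot μ).eventually (eventually_le_nhds (by norm_num))).exists)
    (((tendsto_cdf_atTop μ).eventually (eventually_ge_nhds (by norm_num))).exists)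
  have h3 := map_iInf_Ioi hσ hind hlaw one_le_two y
  rw [Measure.map_congr hae', map_iInf_Ioi hσ hind hlaw le_rfl] at h3
  have h4 : μ.real (Set.Ioi y) = 1 / 2 := by
    rw [← Set.compl_Iic, probReal_compl_eq_one_sub measurableSet_Iic, ← cdf_eq_real, hy]
    norm_num
  have h5 := congrArg ENNReal.toReal h3
  rw [ENNReal.toReal_pow, ENNReal.toReal_pow] at h5
  change μ.real _ ^ 1 = μ.real _ ^ 2 at h5
  rw [h4] at h5
  norm_num at h5

end MinMoment

/-- The service time density vanishes almost everywhere where the distribution function does. -/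
theorem ae_eq_zero_of_cdf_eq_zero {μ : Measure ℝ} [IsProbabilityMeasure μ] [NullSingletonClass μ]
    {g : ℝ → ℝ} (hg : Measurable g) (hg0 : ∀ y, 0 ≤ g y)
    (hμ : μ = volume.withDensity fun y => ENNReal.ofReal (g y)) :
    ∀ᵐ y, cdf μ y = 0 → g y = 0 := by
  have h1 : ∀ᵐ y ∂μ, cdf μ y ≠ 0 := by
    rw [ae_iff]
    refine measure_mono_null (t := {y | cdf μ y ≤ 0}) (fun y hy => ?_) ?_
    · have hy' : cdf μ y = 0 := not_not.1 hy
      exact hy'.le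
    · rw [measure_cdf_le μ le_rfl zero_le_one, ENNReal.ofReal_zero]
  rw [hμ, ae_withDensity_iff hg.ennreal_ofReal, ← hμ] at h1
  filter_upwards [h1] with y hy h0
  by_contra hgy
  exact hy (by simpa using lt_of_le_of_ne (hg0 y) (Ne.symm hgy)) h0

end GatedQueue

/-! ### The main theorem -/

theorem mainTheorem2 {Ω : Type*} [MeasurableSpace Ω] (P : Measure Ω) [IsProbabilityMeasure P]
    (lam : ℝ) (hlam : 0 < lam)
    (σ : ℕ → Ω → ℝ) (g : ℝ → ℝ)
    -- i.i.d. positive service times with density `g` and finite moments of all orders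
    (hσ_meas : ∀ i, Measurable (σ i))
    (hσ_pos : ∀ i, ∀ᵐ ω ∂P, 0 < σ i ω)
    (hσ_indep : iIndepFun σ P)
    (hg_meas : Measurable g) (hg_nonneg : ∀ y, 0 ≤ g y)
    (hσ_law : ∀ i, P.map (σ i) = volume.withDensity fun y => ENNReal.ofReal (g y))
    (hσ_moments : ∀ n : ℕ, Integrable (fun ω => σ 0 ω ^ n) P)
    -- an invariant density of the stage lengths
    (f : ℝ → ℝ) (hf : GatedQueue.IsInvariantDensity P σ lam f) :
    -- all moments of the stationary stage length are finite
    (∀ k : ℕ, IntegrableOn (fun x => x ^ k * f x) (Set.Ioi 0)) ∧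
    -- `f` satisfies the integral equation at almost every point
    (∀ᵐ y ∂volume.restrict (Set.Ici (0 : ℝ)), GatedQueue.IntegralEquationAt P σ lam g f y) ∧
    -- each equation of the linear system holds whenever its series converges
    (∀ i : ℕ, 2 ≤ i → ∀ s : ℝ,
      Tendsto (fun n => ∑ j ∈ Finset.Icc 2 n, GatedQueue.systemTerm P σ lam f i j) atTop (𝓝 s) →
        GatedQueue.moment f i = GatedQueue.minMoment P σ i 1 + s) ∧
    -- the series formula for `f` holds wherever its series converges
    (∀ y : ℝ, 0 ≤ y → GatedQueue.IntegralEquationAt P σ lam g f y → ∀ s : ℝ,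
      Tendsto (fun n => ∑ k ∈ Finset.Icc 2 n, GatedQueue.densityTerm P σ lam f y k) atTop (𝓝 s) →
        f y = g y * (1 + s)) ∧
    -- in light traffic all these series do converge, absolutely
    (Integrable (fun ω => Real.exp (lam * σ 0 ω)) P →
      (∀ i : ℕ, 2 ≤ i →
        Summable (fun j : ℕ => GatedQueue.systemTerm P σ lam f i (j + 2)) ∧
        GatedQueue.moment f i = GatedQueue.minMoment P σ i 1 +
          ∑' j : ℕ, GatedQueue.systemTerm P σ lam f i (j + 2)) ∧
      (∀ y : ℝ, 0 ≤ y → 0 < GatedQueue.serviceCDF P σ y →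
        Summable (fun k : ℕ => GatedQueue.densityTerm P σ lam f y (k + 2)) ∧
        (GatedQueue.IntegralEquationAt P σ lam g f y →
          f y = g y * (1 + ∑' k : ℕ, GatedQueue.densityTerm P σ lam f y (k + 2)))) ∧
      (∀ᵐ y ∂volume.restrict (Set.Ici (0 : ℝ)),
        HasSum (fun k : ℕ => g y * GatedQueue.densityTerm P σ lam f y (k + 2)) (f y - g y))) := by
  set μ : Measure ℝ := volume.withDensity fun y => ENNReal.ofReal (g y) with hμ
  set π : Measure ℝ := volume.withDensity fun y => ENNReal.ofReal (f y) with hπ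
  have hμprob : IsProbabilityMeasure μ :=
    hσ_law 0 ▸ Measure.isProbabilityMeasure_map (hσ_meas 0).aemeasurable
  have hπprob : IsProbabilityMeasure π := hf.isProbability
  have hμac : μ ≪ volume := withDensity_absolutelyContinuous _ _
  have hμna : NullSingletonClass μ := ⟨fun x => hμac (by simp)⟩
  have hposμ : ∀ᵐ y ∂μ, 0 < y := by
    rw [← hσ_law 0, ae_map_iff (hσ_meas 0).aemeasurable measurableSet_Ioi]
    exact hσ_pos 0
  set T := GatedQueue.serviceTail P σ with hTdef
  have hTcdf : ∀ y, T y = 1 - cdf μ y := fun y => by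
    rw [hTdef, GatedQueue.serviceTail, GatedQueue.serviceCDF_eq_cdf (hσ_meas 0) (hσ_law 0)]
  have hT0 : ∀ y, 0 ≤ T y := fun y => by rw [hTcdf]; linarith [cdf_le_one μ y]
  have hT1 : ∀ y, T y ≤ 1 := fun y => by rw [hTcdf]; linarith [cdf_nonneg μ y]
  have hTm : Measurable T := by
    rw [funext hTcdf]
    exact (monotone_cdf μ).measurable.const_sub 1
  have hκ : ∀ x, GatedQueue.stageKernel P σ lam x
      = μ.withDensity fun y => ENNReal.ofReal (GatedQueue.stageWeight lam x (T y)) :=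
    GatedQueue.stageKernel_eq_withDensity hσ_meas hσ_indep hσ_law lam
  have hMarkov := GatedQueue.isMarkovKernel_stageKernel (P := P) hσ_meas lam
  have hinv : (GatedQueue.stageKernel P σ lam).Invariant π := hf.invariant
  have hintμ : ∀ k : ℕ, Integrable (fun y => y ^ k) μ := fun k => by
    rw [← hσ_law 0, integrable_map_measure (by fun_prop) (hσ_meas 0).aemeasurable]
    exact hσ_moments k
  have htrans : ∀ {h : ℝ → ℝ}, Measurable h → Integrable h μ → Integrable h π :=
    GatedQueue.integrable_of_invariant hinv hTm hT0 hκ hlam (hintμ 2)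
  have hint : ∀ k : ℕ, Integrable (fun x => x ^ k) π := fun k => htrans (by fun_prop) (hintμ k)
  have hπΨ := GatedQueue.eq_withDensity_of_invariant hinv hTm hκ
  -- Invariance makes `π` absolutely continuous with respect to `μ`, so positivity of service times
  -- passes to stage lengths.
  have hpos : ∀ᵐ x ∂π, 0 < x := by
    rw [hπΨ]
    exact withDensity_absolutelyContinuous _ _ hposμ
  set R : ℝ → ℝ := fun y => GatedQueue.densityRatio π lam (T y) with hR
  have hR0 : ∀ y, 0 ≤ R y := fun y => GatedQueue.densityRatio_nonneg hlam hpos (T y)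
  have hRm : Measurable R := (GatedQueue.measurable_densityRatio π lam).comp hTm
  have hπR : π = μ.withDensity fun y => ENNReal.ofReal (R y) := by
    refine hπΨ.trans ?_
    congr 1
    ext y
    exact GatedQueue.lintegral_stageWeight_eq hlam hpos (by simpa using hint 1) (hT0 y)
  have hfR : ∀ᵐ y, f y = g y * R y := GatedQueue.ae_eq_mul_of_withDensity_eq hf.measurable
    hf.nonneg hg_meas hg_nonneg hRm hR0 hπR
  have hIE : ∀ y, GatedQueue.IntegralEquationAt P σ lam g f y ↔ f y = g y * R y := fun y => by
    have : ∫ x in Set.Ioi (0 : ℝ), f x * GatedQueue.transitionDensity P σ lam g x y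
        = g y * R y := by
      change _ = g y * GatedQueue.densityRatio π lam (T y)
      rw [GatedQueue.densityRatio, ← GatedQueue.setIntegral_Ioi_mul_eq hf.measurable
        hf.nonneg hpos, ← integral_const_mul]
      refine integral_congr_ae (ae_of_all _ fun x => ?_)
      simp only [GatedQueue.transitionDensity, neg_mul, hTdef]
      ring
    rw [GatedQueue.IntegralEquationAt, this]
  have hmom : ∀ k, GatedQueue.moment f k = ∫ x, x ^ k ∂π := fun k => by
    rw [GatedQueue.moment, ← GatedQueue.setIntegral_Ioi_mul_eq hf.measurable hf.nonneg hpos]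
    simp_rw [mul_comm]
  have hmomInt : ∀ k : ℕ, IntegrableOn (fun x => x ^ k * f x) (Set.Ioi 0) := fun k => by
    have := hint k
    rw [hπ, integrable_withDensity_iff_integrable_smul' hf.measurable.ennreal_ofReal
      (ae_of_all _ fun x => ENNReal.ofReal_lt_top)] at this
    simp only [ENNReal.toReal_ofReal (hf.nonneg _), smul_eq_mul, mul_comm (f _)] at this
    exact this.integrableOn
  have hsystem : ∀ i : ℕ, 2 ≤ i → ∀ s : ℝ,
      Tendsto (fun n => ∑ j ∈ Finset.Icc 2 n, GatedQueue.systemTerm P σ lam f i j) atTop (𝓝 s) →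
        GatedQueue.moment f i = GatedQueue.minMoment P σ i 1 + s := fun i hi s hs => by
    have hσi := hσ_moments i
    set γ := GatedQueue.minMoment P σ i with hγ
    have hlt : γ 2 < γ 1 := GatedQueue.minMoment_two_lt_one hσ_meas hσ_indep hσ_law hσ_pos
      (by lia) hσi
    rw [← sub_eq_iff_eq_add']
    -- The constant compares `γ 1 + γ (n + 1) ≤ 2 * γ 1` with `γ 1 - γ (n + 1) ≥ γ 1 - γ 2 > 0`,
    -- both by monotonicity of `γ`.
    refine GatedQueue.eq_of_tendsto_sum_of_remainder_le (K := 2 * γ 1 / (γ 1 - γ 2)) hs ?_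
    filter_upwards [eventually_ge_atTop 1] with n hn
    rw [sub_sub]
    have hrem := GatedQueue.abs_moment_sub_le hlam hposμ hpos hint hTm hT0 hT1 hπR (hintμ i)
      (γ := γ) (fun k hk => GatedQueue.minMoment_eq_integral hσ_meas hσ_indep hσ_law i hk) hn
    simp only [GatedQueue.systemTerm, hmom]
    refine hrem.trans ?_
    have hb := GatedQueue.integral_pow_nonneg hpos (n + 1)
    have hc : 0 ≤ lam ^ (n + 1) * (∫ x, x ^ (n + 1) ∂π) / ((n + 1)! : ℝ) := by positivity
    have h2 : γ (n + 1) ≤ γ 2 :=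
      GatedQueue.minMoment_anti hσ_meas hσ_pos hσi one_le_two (by lia)
    have h0 : 0 ≤ γ 1 := GatedQueue.minMoment_nonneg hσ_pos i le_rfl
    rw [abs_mul, abs_mul, abs_pow, abs_neg, abs_one, one_pow, one_mul, abs_of_nonneg hc,
      abs_of_nonneg (by linarith : 0 ≤ γ 1 - γ (n + 1)), mul_left_comm]
    refine mul_le_mul_of_nonneg_left ?_ hc
    rw [div_mul_eq_mul_div, le_div_iff₀ (by linarith)]
    have h3 : γ 1 + γ (n + 1) ≤ 2 * γ 1 := by linarith
    exact mul_le_mul h3 (by linarith) (by linarith) (by linarith)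
  have hdensity : ∀ y : ℝ, ∀ s : ℝ,
      Tendsto (fun n => ∑ k ∈ Finset.Icc 2 n, GatedQueue.densityTerm P σ lam f y k) atTop (𝓝 s) →
        R y = 1 + s := fun y s hs => by
    simp only [GatedQueue.densityTerm, hmom] at hs
    exact GatedQueue.densityRatio_eq_of_tendsto hlam hpos hint (hT0 y) (hT1 y) hs
  refine ⟨hmomInt, ae_restrict_of_ae (hfR.mono fun y hy => (hIE y).2 hy), hsystem,
    fun y _ hy s hs => ?_, fun hexp => ?_⟩
  · rw [(hIE y).1 hy, hdensity y s hs]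
  have hexpπ : Integrable (fun x => Real.exp (lam * x)) π := htrans (by fun_prop) <| by
    rw [← hσ_law 0, integrable_map_measure (by fun_prop) (hσ_meas 0).aemeasurable]
    exact hexp
  have hsum := GatedQueue.summable_moments hlam hpos hint hexpπ
  have hc0 : ∀ k : ℕ, 0 ≤ lam ^ k * (∫ x, x ^ k ∂π) / (k ! : ℝ) := fun k => by
    have := GatedQueue.integral_pow_nonneg hpos k
    positivity
  have hdsum : ∀ y, 0 < GatedQueue.serviceCDF P σ y →
      Summable (fun k : ℕ => GatedQueue.densityTerm P σ lam f y (k + 2)) := fun y hy => by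
    have hTlt : T y < 1 := by rw [hTdef, GatedQueue.serviceTail]; linarith
    -- Since `G y > 0` means `T y < 1`, the sequence `k * T y ^ (k - 1)` is bounded, and the terms
    -- are dominated by `1 + B` times the summable moment series.
    obtain ⟨B, hB⟩ := (GatedQueue.tendsto_natCast_mul_pow_sub_one (hT0 y) hTlt).bddAbove_range
    refine (summable_nat_add_iff (f := fun k => GatedQueue.densityTerm P σ lam f y k) 2).2
      ((hsum.mul_right (1 + B)).of_norm_bounded fun k => ?_)
    simp only [GatedQueue.densityTerm, hmom]
    rw [Real.norm_eq_abs, abs_mul, abs_mul, abs_pow, abs_neg, abs_one, one_pow, one_mul,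
      abs_of_nonneg (hc0 k)]
    refine mul_le_mul_of_nonneg_left ((abs_sub _ _).trans ?_) (hc0 k)
    have hk0 : 0 ≤ (k : ℝ) * T y ^ (k - 1) := mul_nonneg k.cast_nonneg (pow_nonneg (hT0 y) _)
    rw [abs_one, abs_of_nonneg hk0]
    exact add_le_add le_rfl (hB ⟨k, rfl⟩)
  refine ⟨fun i hi => ?_, fun y _ hy => ⟨hdsum y hy, fun hIEy => ?_⟩, ae_restrict_of_ae ?_⟩
  · have hS : Summable (fun j : ℕ => GatedQueue.systemTerm P σ lam f i (j + 2)) := by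
      refine ((hsum.comp_injective (add_left_injective 2)).mul_right
        (GatedQueue.minMoment P σ i 1)).of_norm_bounded fun j => ?_
      have h1 := GatedQueue.minMoment_nonneg hσ_pos i (k := j + 2) (by lia)
      have h2 := GatedQueue.minMoment_anti hσ_meas hσ_pos (hσ_moments i) le_rfl
        (show 1 ≤ j + 2 by lia)
      simp only [GatedQueue.systemTerm, hmom, Function.comp_apply]
      rw [Real.norm_eq_abs, abs_mul, abs_mul, abs_pow, abs_neg, abs_one, one_pow, one_mul,
        abs_of_nonneg (hc0 _), abs_of_nonneg (sub_nonneg.2 h2)]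
      exact mul_le_mul_of_nonneg_left (by linarith) (hc0 _)
    exact ⟨hS, hsystem i hi _ (GatedQueue.tendsto_sum_Icc_two hS)⟩
  · rw [(hIE y).1 hIEy, hdensity y _ (GatedQueue.tendsto_sum_Icc_two (hdsum y hy))]
  · filter_upwards [hfR, GatedQueue.ae_eq_zero_of_cdf_eq_zero hg_meas hg_nonneg hμ] with y hy hy0
    -- Where `G y = 0` the domination above is lost, but `g` vanishes almost everywhere there, so
    -- both sides are 0.
    rcases eq_or_lt_of_le (cdf_nonneg μ y) with h | h
    · simp [hy, hy0 h.symm]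
    · rw [← GatedQueue.serviceCDF_eq_cdf (hσ_meas 0) (hσ_law 0)] at h
      have hS := hdsum y h
      have := hS.hasSum.mul_left (g y)
      rwa [hy, hdensity y _ (GatedQueue.tendsto_sum_Icc_two hS), mul_add, mul_one,
        add_sub_cancel_left]
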